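/- Let $N\in\mathbb N$, $T>0$, and let $H:\mathbb R^N\times\mathbb R^N\to\mathbb R$ be convex and lower semicontinuous, with $H(p,q)\to+\infty$ as $|p|+|q|\to\infty$. Assume that there are constants $\alpha,\beta>0$ and $1<r<\infty$ such that $$-\alpha\le H(p,q)\le \beta\,(|p|^r+|q|^r+1)\qquad\text{for all } (p,q)\in\mathbb R^N\times\mathbb R^N.$$ Let $H^*(u,v)=\sup_{p,q}\{u\cdot p+v\cdot q-H(p,q)\}\in(-\infty,+\infty]$ be the Legendre–Fenchel conjugate of $H$, let $X=W^{1,2}(0,T;\mathbb R^N)$ (absolutely continuous $p:[0,T]\to\mathbb R^N$ with $\dot p\in L^2$), let $p_0,q_0\in\mathbb R^N$, and let $D=\{(p,q)\in X\times X:\ p(0)=p_0,\ q(0)=q_0\}$. Then the functional $$J(p,q)=\int_0^T\big[H(p(t),q(t))+H^*(-\dot q(t),\dot p(t))+\dot q(t)\cdot p(t)-\dot p(t)\cdot q(t)\big]\,dt\in(-\infty,+\infty]$$ satisfies $\inf_{D}J=0$, and this infimum is attained at some $(p,q)\in D$ which solves the Cauchy problem $$\dot p(t)\in\partial_2H(p(t),q(t)),\qquad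 -\dot q(t)\in\partial_1H(p(t),q(t))\quad\text{for a.e. }t\in(0,T),\qquad p(0)=p_0,\ q(0)=q_0,$$ and for which moreover the two inclusions hold jointly, $(-\dot q(t),\dot p(t))\in\partial H(p(t),q(t))$ for a.e. $t\in(0,T)$. Here $\partial_1H(p,q)$ and $\partial_2H(p,q)$ are the subdifferentials of $H(\cdot,q)$ at $p$ and of $H(p,\cdot)$ at $q$, and $\partial H$ is the subdifferential of $H$ on $\mathbb R^{2N}$. -/

import Mathlib

open MeasureTheory Set Filter Topology

noncomputable section

namespace HamiltonianCauchy

/-- The Euclidean space `ℝ^N`. -/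
abbrev Euc (N : ℕ) : Type := EuclideanSpace ℝ (Fin N)

/-- The Legendre-Fenchel conjugate of `H : ℝ^N × ℝ^N → ℝ` for the inner product
`(p, q) · (u, v) = p · u + q · v`. It may take the value `+∞`. -/
def conj {N : ℕ} (H : Euc N × Euc N → ℝ) (y : Euc N × Euc N) : EReal :=
  ⨆ x : Euc N × Euc N, ((inner ℝ y.1 x.1 + inner ℝ y.2 x.2 - H x : ℝ) : EReal)

/-- The subdifferential of `H` at `x`, in both variables jointly. -/
def subdiff {N : ℕ} (H : Euc N × Euc N → ℝ) (x : Euc N × Euc N) : Set (Euc N × Euc N) :=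
  {y | ∀ z, H x + (inner ℝ y.1 (z.1 - x.1) + inner ℝ y.2 (z.2 - x.2)) ≤ H z}

/-- The partial subdifferential `∂₁H(p, q)`: the subdifferential of `H(·, q)` at `p`. -/
def subdiffFst {N : ℕ} (H : Euc N × Euc N → ℝ) (p q : Euc N) : Set (Euc N) :=
  {u | ∀ z, H (p, q) + inner ℝ u (z - p) ≤ H (z, q)}

/-- The partial subdifferential `∂₂H(p, q)`: the subdifferential of `H(p, ·)` at `q`. -/
def subdiffSnd {N : ℕ} (H : Euc N × Euc N → ℝ) (p q : Euc N) : Set (Euc N) :=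
  {v | ∀ z, H (p, q) + inner ℝ v (z - q) ≤ H (p, z)}

/-- Membership in `X = W^{1,2}(0, T; ℝ^N)`, for the continuous representative on `[0, T]`:
`p` is absolutely continuous on `[0, T]` and its (almost everywhere defined) derivative is in
`L²(0, T; ℝ^N)`. Values of `p` outside `[0, T]` play no role. -/
def IsW12 {N : ℕ} (T : ℝ) (p : ℝ → Euc N) : Prop :=
  AbsolutelyContinuousOnInterval p 0 T ∧ MemLp (deriv p) 2 (volume.restrict (Ioo 0 T))

/-- The set `D` of pairs `(p, q) ∈ X × X` with `p(0) = p₀` and `q(0) = q₀`. -/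
def pathsFrom {N : ℕ} (T : ℝ) (p₀ q₀ : Euc N) : Set ((ℝ → Euc N) × (ℝ → Euc N)) :=
  {c | IsW12 T c.1 ∧ IsW12 T c.2 ∧ c.1 0 = p₀ ∧ c.2 0 = q₀}

/-- The integral over `(0, T)` of an extended-real-valued function:
the integral of the positive part minus the integral of the negative part. -/
def eintegral (T : ℝ) (f : ℝ → EReal) : EReal :=
  ((∫⁻ t in Ioo 0 T, (f t).toENNReal : ENNReal) : EReal)
    - ((∫⁻ t in Ioo 0 T, (-f t).toENNReal : ENNReal) : EReal)

/-- The functional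
`J(p, q) = ∫₀ᵀ [H(p, q) + H*(-q̇, ṗ) + q̇ · p - ṗ · q] dt`, with `c = (p, q)`. -/
def actionJ {N : ℕ} (H : Euc N × Euc N → ℝ) (T : ℝ) (c : (ℝ → Euc N) × (ℝ → Euc N)) : EReal :=
  eintegral T fun t =>
    (H (c.1 t, c.2 t) : EReal) + conj H (-deriv c.2 t, deriv c.1 t)
      + ((inner ℝ (deriv c.2 t) (c.1 t) - inner ℝ (deriv c.1 t) (c.2 t) : ℝ) : EReal)

/-- `(p, q)` solves the Cauchy problem `ṗ ∈ ∂₂H(p, q)`, `-q̇ ∈ ∂₁H(p, q)` a.e. on `(0, T)`,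
`p(0) = p₀`, `q(0) = q₀`, in the class `W^{1,2}`. -/
structure IsSolution {N : ℕ} (H : Euc N × Euc N → ℝ) (T : ℝ) (p₀ q₀ : Euc N)
    (p q : ℝ → Euc N) : Prop where
  memFst : IsW12 T p
  memSnd : IsW12 T q
  initFst : p 0 = p₀
  initSnd : q 0 = q₀
  differentiable : ∀ᵐ t ∂(volume.restrict (Ioo 0 T)),
    DifferentiableAt ℝ p t ∧ DifferentiableAt ℝ q t
  eqFst : ∀ᵐ t ∂(volume.restrict (Ioo 0 T)), deriv p t ∈ subdiffSnd H (p t) (q t)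
  eqSnd : ∀ᵐ t ∂(volume.restrict (Ioo 0 T)), -deriv q t ∈ subdiffFst H (p t) (q t)
  /-- The two inclusions hold jointly: `(-q̇, ṗ) ∈ ∂H(p, q)`. -/
  eqJoint : ∀ᵐ t ∂(volume.restrict (Ioo 0 T)), (-deriv q t, deriv p t) ∈ subdiff H (p t, q t)

end HamiltonianCauchy

end

/-!
By the Fenchel-Young inequality the integrand of `actionJ` is nonnegative (`integrand_nonneg`), and it
vanishes at `t` as soon as `(-q', p') ∈ ∂H(p, q)` there (`integrand_eq_zero`). So everything reduces
to the existence of one path in `D` solving the joint inclusion almost everywhere. With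
`z = (p, q)` and the symplectic rotation `J (u, v) = (v, -u)`, this inclusion reads
`-J z' ∈ ∂H(z)`.

Such a path is obtained from the explicit Euler scheme rather than by minimization.

* If `H` is convex and globally Lipschitz, its subgradients are bounded, and the Euler iterates for
  an arbitrary selection of `∂H` are uniformly Lipschitz in time. They converge pointwise along a
  free ultrafilter to a Lipschitz path `z` (`exists_lipschitz_limit_eulerStep`). For a fixed test
  point `w`, the subgradient inequality is a linear constraint on the increments of the scheme, so it
  can be summed and passed to the limit (`inner_limit_sub_le`); dividing by the length of the time
  interval gives `-J z' ∈ ∂H(z)` wherever `z` is differentiable.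
* Along such a path `(H ∘ z)' = ⟪-J z', z'⟫ = 0` almost everywhere, since `J` is skew, so `H` is
  conserved (`exists_solution_of_lipschitz`).
* A general coercive `H` is replaced by a globally Lipschitz convex minorant `f ≤ H` that coincides
  with `H` on a large ball (`exists_lipschitz_convex_minorant`). Conservation of `f` and coercivity
  of `H` keep the path in that ball, where a subgradient of `f` is a subgradient of `H`
  (`exists_solution_of_bounded_sublevel`).
-/

open MeasureTheory Set Filter Topology

noncomputable section

namespace HamiltonianCauchy

/-! ### Subgradients and Lipschitz minorants of convex functions -/

section Subgradient

variable {V : Type*} [NormedAddCommGroup V] [InnerProductSpace ℝ V]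

/-- `g` is a subgradient of `f : V → ℝ` at `x`, the dual of `V` being identified with `V`. -/
def IsSubgradient (f : V → ℝ) (x g : V) : Prop :=
  ∀ w, f x + inner ℝ g (w - x) ≤ f w

/-- The supporting hyperplane theorem: the open strict epigraph is separated from the boundary
point `(x, f x)`, and the separating hyperplane cannot be vertical because `f` is finite
everywhere. -/
theorem exists_isSubgradient [CompleteSpace V] {f : V → ℝ} (hf : ConvexOn ℝ univ f)
    (hc : Continuous f) (x : V) : ∃ g, IsSubgradient f x g := by
  have hconv : Convex ℝ {a : V × ℝ | a.1 ∈ univ ∧ f a.1 < a.2} := hf.convex_strict_epigraph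
  have hopen : IsOpen {a : V × ℝ | a.1 ∈ univ ∧ f a.1 < a.2} := by
    simp only [mem_univ, true_and]
    exact isOpen_lt (hc.comp continuous_fst) continuous_snd
  obtain ⟨φ, hφ⟩ := geometric_hahn_banach_open_point hconv hopen (x := (x, f x)) (by simp)
  set c : ℝ := φ (0, 1) with hcdef
  set l : StrongDual ℝ V := φ.comp (ContinuousLinearMap.inl ℝ V ℝ) with hl
  have hdec : ∀ (w : V) (s : ℝ), φ (w, s) = l w + s * c := by
    intro w s
    have : ((w, s) : V × ℝ) = (w, 0) + s • ((0 : V), (1 : ℝ)) := by simp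
    rw [this, map_add, map_smul]
    simp [hl, hcdef]
  have hlt : ∀ w s, f w < s → l w + s * c < l x + f x * c := by
    intro w s hs
    have := hφ (w, s) ⟨mem_univ _, hs⟩
    rwa [hdec, hdec] at this
  have hcneg : c < 0 := by
    have := hlt x (f x + 1) (by linarith)
    linarith
  have hle : ∀ w, l w + f w * c ≤ l x + f x * c := by
    intro w
    refine le_of_forall_pos_lt_add fun ε hε => ?_
    have h1 := hlt w (f w + ε / (-c)) (by
      have : 0 < ε / (-c) := div_pos hε (by linarith)
      linarith)
    have h2 : ε / (-c) * c = -ε := by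
      rw [div_neg, neg_mul, div_mul_cancel₀ _ hcneg.ne]
    rw [add_mul, h2] at h1
    linarith
  refine ⟨(-c)⁻¹ • (InnerProductSpace.toDual ℝ V).symm l, fun w => ?_⟩
  rw [inner_smul_left, InnerProductSpace.toDual_symm_apply, map_sub]
  have h := hle w
  have h3 : (-c)⁻¹ * (l w - l x) ≤ f w - f x := by
    rw [inv_mul_le_iff₀ (by linarith)]
    linarith
  simpa using (by linarith : f x + (-c)⁻¹ * (l w - l x) ≤ f w)

theorem IsSubgradient.norm_le_of_lipschitzWith {f : V → ℝ} {K : NNReal} (hf : LipschitzWith K f)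
    {x g : V} (hg : IsSubgradient f x g) : ‖g‖ ≤ K := by
  have h1 := hg (x + g)
  have h2 := hf.le_add_mul (x + g) x
  simp only [add_sub_cancel_left, real_inner_self_eq_norm_sq, dist_self_add_left] at h1 h2
  rcases (norm_nonneg g).eq_or_lt with h | h
  · rw [← h]; exact K.2
  · nlinarith

/-- On a ball, subgradients are bounded by the oscillation of the function on the concentric ball
with radius larger by one. -/
theorem IsSubgradient.norm_le_of_abs_le {f : V → ℝ} {C R : ℝ}
    (hC : ∀ y ∈ Metric.closedBall (0 : V) (R + 1), |f y| ≤ C) {x g : V}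
    (hx : x ∈ Metric.closedBall (0 : V) R) (hg : IsSubgradient f x g) : ‖g‖ ≤ 2 * C := by
  rw [mem_closedBall_zero_iff] at hx
  rcases (norm_nonneg g).eq_or_lt with h | h
  · have := (abs_nonneg _).trans (hC x (by rw [mem_closedBall_zero_iff]; linarith))
    rw [← h]; linarith
  · have hn : ‖‖g‖⁻¹ • g‖ = 1 := by rw [norm_smul, norm_inv, norm_norm, inv_mul_cancel₀ h.ne']
    have h1 := hg (x + ‖g‖⁻¹ • g)
    rw [add_sub_cancel_left, inner_smul_right, real_inner_self_eq_norm_sq, sq, ← mul_assoc,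
      inv_mul_cancel₀ h.ne', one_mul] at h1
    have h2 := abs_le.1 (hC x (by rw [mem_closedBall_zero_iff]; linarith))
    have h3 := abs_le.1 (hC (x + ‖g‖⁻¹ • g) (by
      rw [mem_closedBall_zero_iff]
      exact (norm_add_le _ _).trans (by rw [hn]; linarith)))
    linarith

/-- A finite convex function can be modified outside a ball so as to become globally Lipschitz,
without exceeding the original function: take the supremum of the affine minorants that support it
at the points of the ball. -/
theorem exists_lipschitz_convex_minorant [FiniteDimensional ℝ V] {f : V → ℝ}
    (hf : ConvexOn ℝ univ f) {R : ℝ} (hR : 0 ≤ R) :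
    ∃ (K : NNReal) (f' : V → ℝ), ConvexOn ℝ univ f' ∧ LipschitzWith K f' ∧
      (∀ w, f' w ≤ f w) ∧ ∀ x, ‖x‖ ≤ R → f' x = f x := by
  have : CompleteSpace V := FiniteDimensional.complete ℝ V
  have : ProperSpace V := FiniteDimensional.proper ℝ V
  have hc : Continuous f := hf.locallyLipschitz.continuous
  choose g hg using exists_isSubgradient hf hc
  obtain ⟨C, hC⟩ := (isCompact_closedBall (0 : V) (R + 1)).exists_bound_of_continuousOn
    hc.continuousOn
  simp only [Real.norm_eq_abs] at hC
  have hC0 : 0 ≤ C := (abs_nonneg _).trans (hC 0 (by simp; linarith))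
  let a : Metric.closedBall (0 : V) R → V → ℝ := fun x w => f x + inner ℝ (g x) (w - x)
  have hne : Nonempty (Metric.closedBall (0 : V) R) := ⟨⟨0, by simpa using hR⟩⟩
  have hbdd : ∀ w, BddAbove (range fun x => a x w) := fun w =>
    ⟨f w, by rintro _ ⟨x, rfl⟩; exact hg x w⟩
  have hale : ∀ x w, a x w ≤ ⨆ x, a x w := fun x w => le_ciSup (hbdd w) x
  refine ⟨⟨2 * C, by positivity⟩, fun w => ⨆ x, a x w, ⟨convex_univ, ?_⟩,
    LipschitzWith.of_le_add_mul _ ?_, fun w => ciSup_le fun x => hg x w, fun x hx => ?_⟩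
  · intro v _ w _ s t hs ht hst
    refine ciSup_le fun x => ?_
    have h1 : a x (s • v + t • w) = s * a x v + t * a x w := by
      have : s • v + t • w - (x : V) = s • (v - x) + t • (w - x) := by
        have : (x : V) = (s + t) • (x : V) := by rw [hst, one_smul]
        rw [smul_sub, smul_sub]
        nth_rewrite 1 [this]
        rw [add_smul]; abel
      simp only [a, this, inner_add_right, inner_smul_right]
      linear_combination (-f x) * hst
    rw [h1, smul_eq_mul, smul_eq_mul]
    exact add_le_add (mul_le_mul_of_nonneg_left (hale x v) hs)
      (mul_le_mul_of_nonneg_left (hale x w) ht)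
  · intro v w
    refine ciSup_le fun x => ?_
    have h1 : a x v = a x w + inner ℝ (g x) (v - w) := by
      have : v - (x : V) = (w - x) + (v - w) := by abel
      simp only [a]
      rw [this, inner_add_right]; ring
    have h2 : inner ℝ (g x) (v - w) ≤ 2 * C * dist v w := by
      rw [dist_eq_norm]
      exact (real_inner_le_norm _ _).trans
        (mul_le_mul_of_nonneg_right ((hg x).norm_le_of_abs_le hC x.2) (norm_nonneg _))
    rw [h1]
    exact add_le_add (hale x w) h2
  · refine le_antisymm (ciSup_le fun y => hg y x) ?_
    have := hale ⟨x, by simpa using hx⟩ x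
    simpa [a] using this

end Subgradient

/-! ### The Euler scheme and its limit along an ultrafilter -/

section EulerScheme

variable {V : Type*} [NormedAddCommGroup V] [NormedSpace ℝ V]

/-- The explicit Euler scheme with step `n⁻¹` for the (possibly discontinuous) vector field `F`.
For `n = 0` the step is `0⁻¹ = 0`, so the scheme is constant; only large `n` matter. -/
def euler (F : V → V) (x₀ : V) (n : ℕ) : ℕ → V
  | 0 => x₀
  | k + 1 => euler F x₀ n k + (n : ℝ)⁻¹ • F (euler F x₀ n k)

theorem dist_euler_le {F : V → V} {M : ℝ} (hF : ∀ x, ‖F x‖ ≤ M) (x₀ : V) (n a b : ℕ) :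
    dist (euler F x₀ n b) (euler F x₀ n a) ≤ M * |(b : ℝ) / n - (a : ℝ) / n| := by
  have key : ∀ a m : ℕ, dist (euler F x₀ n (a + m)) (euler F x₀ n a) ≤ M * ((m : ℝ) / n) := by
    intro a m
    induction m with
    | zero => simp
    | succ m ih =>
      refine (dist_triangle _ (euler F x₀ n (a + m)) _).trans ?_
      have h1 : dist (euler F x₀ n (a + m + 1)) (euler F x₀ n (a + m)) ≤ (n : ℝ)⁻¹ * M := by
        rw [euler, dist_self_add_left, norm_smul, norm_inv, Real.norm_natCast]
        exact mul_le_mul_of_nonneg_left (hF _) (by positivity)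
      calc _ ≤ (n : ℝ)⁻¹ * M + M * ((m : ℝ) / n) := add_le_add h1 ih
        _ = M * (((m + 1 : ℕ) : ℝ) / n) := by push_cast; ring
  have hM : 0 ≤ M := (norm_nonneg _).trans (hF x₀)
  rcases le_total a b with h | h
  · obtain ⟨m, rfl⟩ := Nat.exists_eq_add_of_le h
    refine (key a m).trans (mul_le_mul_of_nonneg_left ?_ hM)
    refine le_trans (le_of_eq ?_) (le_abs_self _)
    push_cast; ring
  · obtain ⟨m, rfl⟩ := Nat.exists_eq_add_of_le h
    rw [dist_comm, abs_sub_comm]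
    refine (key b m).trans (mul_le_mul_of_nonneg_left ?_ hM)
    refine le_trans (le_of_eq ?_) (le_abs_self _)
    push_cast; ring

/-- The Euler iterate with step `n⁻¹` at time `t`, as a step function of `t`, constant for
`t ≤ 0`. -/
def eulerStep (F : V → V) (x₀ : V) (n : ℕ) (t : ℝ) : V :=
  euler F x₀ n ⌊max t 0 * n⌋₊

theorem tendsto_natFloor_mul_div (t : ℝ) :
    Tendsto (fun n : ℕ => (⌊max t 0 * n⌋₊ : ℝ) / n) (hyperfilter ℕ) (𝓝 (max t 0)) :=
  ((tendsto_nat_floor_mul_div_atTop (le_max_right t 0)).comp tendsto_natCast_atTop_atTop).mono_left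
    Nat.hyperfilter_le_atTop

/-- Instead of extracting a uniformly convergent subsequence, the limit of the Euler scheme is
taken pointwise along a free ultrafilter. -/
theorem exists_lipschitz_limit_eulerStep [ProperSpace V] {F : V → V} {M : NNReal}
    (hF : ∀ x, ‖F x‖ ≤ M) (x₀ : V) :
    ∃ z : ℝ → V, z 0 = x₀ ∧ LipschitzWith M z ∧
      ∀ t, Tendsto (fun n => eulerStep F x₀ n t) (hyperfilter ℕ) (𝓝 (z t)) := by
  have hex : ∀ t, ∃ y, Tendsto (fun n => eulerStep F x₀ n t) (hyperfilter ℕ) (𝓝 y) := by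
    intro t
    have hmem : ∀ n, eulerStep F x₀ n t ∈ Metric.closedBall x₀ (M * max t 0) := by
      intro n
      have h := dist_euler_le hF x₀ n 0 ⌊max t 0 * n⌋₊
      rw [Metric.mem_closedBall]
      refine h.trans (mul_le_mul_of_nonneg_left ?_ M.2)
      rw [Nat.cast_zero, zero_div, sub_zero, abs_of_nonneg (by positivity)]
      rcases n.eq_zero_or_pos with rfl | hn
      · simp
      · rw [div_le_iff₀ (by exact_mod_cast hn)]
        exact Nat.floor_le (by positivity)
    obtain ⟨y, -, hy⟩ := (isCompact_closedBall x₀ (M * max t 0)).ultrafilter_le_nhds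
      ((hyperfilter ℕ).map fun n => eulerStep F x₀ n t)
      (le_principal_iff.2 (Filter.mem_map.2 (univ_mem' hmem)))
    exact ⟨y, hy⟩
  choose z hz using hex
  refine ⟨z, ?_, LipschitzWith.of_dist_le_mul fun t s => ?_, hz⟩
  · refine tendsto_nhds_unique (hz 0) (tendsto_const_nhds.congr fun n => ?_)
    simp [eulerStep, euler]
  · have h1 : dist (z t) (z s) ≤ M * |max t 0 - max s 0| :=
      le_of_tendsto_of_tendsto ((hz t).dist (hz s))
        (((tendsto_natFloor_mul_div t).sub (tendsto_natFloor_mul_div s)).abs.const_mul (M : ℝ))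
        (Eventually.of_forall fun n => dist_euler_le hF x₀ n _ _)
    refine h1.trans (mul_le_mul_of_nonneg_left ?_ M.2)
    rw [Real.dist_eq]
    exact abs_max_sub_max_le_abs t s 0

end EulerScheme

/-! ### The Hamiltonian inclusion in a Euclidean space -/

section HamiltonianInclusion

variable {V : Type*} [NormedAddCommGroup V] [InnerProductSpace ℝ V]

/-- Summing the subgradient inequalities at the Euler iterates `x_a, …, x_{a + m}`, with all of
them moved to a nearby base point `y`. -/
theorem inner_euler_sub_le {f : V → ℝ} {K : NNReal} (hf : LipschitzWith K f) {G : V → V}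
    (hG : ∀ x, IsSubgradient f x (G x)) {J : V →L[ℝ] V} (hJ : ∀ v, J (J v) = -v) (x₀ y w : V)
    (n a : ℕ) {δ : ℝ} (m : ℕ)
    (hδ : ∀ k, k ≤ m → dist (euler (fun x => J (G x)) x₀ n (a + k)) y ≤ δ) :
    inner ℝ (-J (euler (fun x => J (G x)) x₀ n (a + m) - euler (fun x => J (G x)) x₀ n a)) (w - y)
      ≤ (m : ℝ) / n * (f w - f y + 2 * K * δ) := by
  induction m with
  | zero => simp
  | succ m ih =>
    have ih := ih fun k hk => hδ k (hk.trans m.le_succ)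
    set X := euler (fun x => J (G x)) x₀ n with hX
    have hstep : -J (X (a + (m + 1)) - X a) = -J (X (a + m) - X a) + (n : ℝ)⁻¹ • G (X (a + m)) := by
      have : X (a + (m + 1)) = X (a + m) + (n : ℝ)⁻¹ • J (G (X (a + m))) := rfl
      rw [this, add_sub_right_comm, map_add, map_smul, hJ, smul_neg, neg_add, neg_neg]
    have hd : dist (X (a + m)) y ≤ δ := hδ m m.le_succ
    have h1 := hG (X (a + m)) w
    have h2 : f y ≤ f (X (a + m)) + K * δ :=
      (hf.le_add_mul y (X (a + m))).trans (by
        rw [dist_comm]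
        exact add_le_add_right (mul_le_mul_of_nonneg_left hd K.2) _)
    have h3 : inner ℝ (G (X (a + m))) (X (a + m) - y) ≤ K * δ := by
      refine (real_inner_le_norm _ _).trans ?_
      rw [← dist_eq_norm]
      exact mul_le_mul ((hG _).norm_le_of_lipschitzWith hf) hd dist_nonneg K.2
    have h4 : inner ℝ (G (X (a + m))) (w - y) ≤ f w - f y + 2 * K * δ := by
      have : w - y = (w - X (a + m)) + (X (a + m) - y) := by abel
      rw [this, inner_add_right]
      linarith
    have hn : 0 ≤ (n : ℝ)⁻¹ := by positivity
    rw [hstep, inner_add_left, inner_smul_left, RCLike.conj_to_real]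
    calc _ ≤ (m : ℝ) / n * (f w - f y + 2 * K * δ) + (n : ℝ)⁻¹ * (f w - f y + 2 * K * δ) :=
          add_le_add ih (mul_le_mul_of_nonneg_left h4 hn)
      _ = _ := by push_cast; ring

/-- Passage to the limit in `inner_euler_sub_le` over a time interval `[t, t + h]`, on which the
scheme stays within distance about `‖J‖ K h` of `z t`. -/
theorem inner_limit_sub_le {f : V → ℝ} {K M : NNReal} (hf : LipschitzWith K f) {G : V → V}
    (hG : ∀ x, IsSubgradient f x (G x)) {J : V →L[ℝ] V} (hJ : ∀ v, J (J v) = -v)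
    (hM : ∀ x, ‖J (G x)‖ ≤ M) {x₀ : V} {z : ℝ → V}
    (hz : ∀ t, Tendsto (fun n => eulerStep (fun x => J (G x)) x₀ n t) (hyperfilter ℕ) (𝓝 (z t)))
    {t h : ℝ} (ht : 0 ≤ t) (hh : 0 ≤ h) (w : V) :
    inner ℝ (-J (z (t + h) - z t)) (w - z t) ≤ h * (f w - f (z t) + 2 * K * (M * h)) := by
  have hlim1 : Tendsto (fun n => inner ℝ (-J (eulerStep (fun x => J (G x)) x₀ n (t + h)
      - eulerStep (fun x => J (G x)) x₀ n t)) (w - z t)) (hyperfilter ℕ)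
      (𝓝 (inner ℝ (-J (z (t + h) - z t)) (w - z t))) :=
    ((J.continuous.tendsto _).comp ((hz (t + h)).sub (hz t))).neg.inner tendsto_const_nhds
  have hρ : Tendsto (fun n : ℕ => (⌊max (t + h) 0 * n⌋₊ : ℝ) / n - (⌊max t 0 * n⌋₊ : ℝ) / n)
      (hyperfilter ℕ) (𝓝 h) := by
    have := (tendsto_natFloor_mul_div (t + h)).sub (tendsto_natFloor_mul_div t)
    simpa only [max_eq_left ht, max_eq_left (add_nonneg ht hh), add_sub_cancel_left] using this
  have hd : Tendsto (fun n => dist (eulerStep (fun x => J (G x)) x₀ n t) (z t)) (hyperfilter ℕ)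
      (𝓝 0) := by
    simpa using (hz t).dist (tendsto_const_nhds (x := z t))
  have hlim2 := hρ.mul (((hρ.const_mul (M : ℝ)).add hd).const_mul (2 * (K : ℝ)) |>.const_add
    (f w - f (z t)))
  rw [add_zero] at hlim2
  refine le_of_tendsto_of_tendsto hlim1 hlim2 (Eventually.of_forall fun n => ?_)
  have hab : ⌊max t 0 * n⌋₊ ≤ ⌊max (t + h) 0 * n⌋₊ := by
    refine Nat.floor_mono (mul_le_mul_of_nonneg_right ?_ (Nat.cast_nonneg n))
    exact max_le_max_right 0 (by linarith)
  obtain ⟨m, hm⟩ := Nat.exists_eq_add_of_le hab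
  have hmn : (⌊max (t + h) 0 * n⌋₊ : ℝ) / n - (⌊max t 0 * n⌋₊ : ℝ) / n = (m : ℝ) / n := by
    rw [hm]; push_cast; ring
  have hb : eulerStep (fun x => J (G x)) x₀ n (t + h)
      = euler (fun x => J (G x)) x₀ n (⌊max t 0 * n⌋₊ + m) := by
    rw [eulerStep, hm]
  simp only [hmn, hb]
  refine inner_euler_sub_le hf hG hJ x₀ (z t) w n ⌊max t 0 * n⌋₊ m fun k hk => ?_
  refine (dist_triangle _ (eulerStep (fun x => J (G x)) x₀ n t) _).trans
    (add_le_add_left ?_ _)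
  refine (dist_euler_le hM x₀ n ⌊max t 0 * n⌋₊ (⌊max t 0 * n⌋₊ + k)).trans
    (mul_le_mul_of_nonneg_left ?_ M.2)
  rw [Nat.cast_add, add_div, add_sub_cancel_left, abs_of_nonneg (by positivity)]
  gcongr

/-- A subgradient `g` of `f` at `z t` gives the derivative of `f ∘ z` at `t` as soon as it exists,
because `s ↦ f (z s) - ⟪g, z s⟫` is minimal at `t`. -/
theorem IsSubgradient.deriv_comp {f : V → ℝ} {z : ℝ → V} {g v : V} {t c : ℝ}
    (hg : IsSubgradient f (z t) g) (hz : HasDerivAt z v t)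
    (hfz : HasDerivAt (fun s => f (z s)) c t) : c = inner ℝ g v := by
  have hmin : IsLocalMin (fun s => f (z s) - inner ℝ g (z s)) t :=
    Eventually.of_forall fun s => by
      have := hg (z s)
      rw [inner_sub_right] at this
      change f (z t) - inner ℝ g (z t) ≤ f (z s) - inner ℝ g (z s)
      linarith
  have hd : HasDerivAt (fun s => inner ℝ g (z s)) (inner ℝ g v) t := by
    simpa using (hasDerivAt_const t g).inner ℝ hz
  have := hmin.hasDerivAt_eq_zero (hfz.sub hd)
  linarith

/-- Existence for `-J z' ∈ ∂f(z)` with a globally Lipschitz convex `f`. Skewness of `J` makes `f`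
constant along the solution. -/
theorem exists_solution_of_lipschitz [FiniteDimensional ℝ V] {f : V → ℝ} {K : NNReal}
    (hconv : ConvexOn ℝ univ f) (hf : LipschitzWith K f) {J : V →L[ℝ] V}
    (hJ : ∀ v, J (J v) = -v) (hskew : ∀ v, inner ℝ (J v) v = 0) (x₀ : V) :
    ∃ (z : ℝ → V) (M : NNReal), z 0 = x₀ ∧ LipschitzWith M z ∧
      (∀ᵐ t, 0 < t → DifferentiableAt ℝ z t ∧ IsSubgradient f (z t) (-J (deriv z t))) ∧
      ∀ t, 0 ≤ t → f (z t) = f x₀ := by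
  have : CompleteSpace V := FiniteDimensional.complete ℝ V
  have : ProperSpace V := FiniteDimensional.proper ℝ V
  choose G hG using exists_isSubgradient hconv hf.continuous
  have hM : ∀ x, ‖J (G x)‖ ≤ ((‖J‖₊ * K : NNReal) : ℝ) := fun x =>
    (J.le_opNorm _).trans
      (mul_le_mul_of_nonneg_left ((hG x).norm_le_of_lipschitzWith hf) (norm_nonneg _))
  obtain ⟨z, hz0, hzL, hz⟩ := exists_lipschitz_limit_eulerStep hM x₀
  have hincl : ∀ᵐ t, 0 < t → DifferentiableAt ℝ z t ∧ IsSubgradient f (z t) (-J (deriv z t)) := by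
    filter_upwards [hzL.ae_differentiableAt_real] with t hdt ht
    refine ⟨hdt, fun w => ?_⟩
    have hslope := hdt.hasDerivAt.tendsto_slope_zero_right
    have h1 : Tendsto (fun h : ℝ => inner ℝ (-J (h⁻¹ • (z (t + h) - z t))) (w - z t)) (𝓝[>] 0)
        (𝓝 (inner ℝ (-J (deriv z t)) (w - z t))) :=
      ((J.continuous.tendsto _).comp hslope).neg.inner tendsto_const_nhds
    have h2 : Tendsto (fun h : ℝ => f w - f (z t) + 2 * K * (((‖J‖₊ * K : NNReal) : ℝ) * h))
        (𝓝[>] 0) (𝓝 (f w - f (z t) + 2 * K * (((‖J‖₊ * K : NNReal) : ℝ) * 0))) := by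
      refine Tendsto.mono_left (Continuous.tendsto ?_ _) nhdsWithin_le_nhds
      fun_prop
    have h3 := le_of_tendsto_of_tendsto h1 h2 (by
      filter_upwards [self_mem_nhdsWithin] with h hh
      have hh : 0 < h := hh
      have := inner_limit_sub_le hf hG hJ hM hz ht.le hh.le w
      rw [map_smul, ← smul_neg, inner_smul_left, RCLike.conj_to_real, inv_mul_le_iff₀ hh]
      exact this)
    rw [mul_zero, mul_zero, add_zero] at h3
    linarith
  refine ⟨z, _, hz0, hzL, hincl, fun t ht => ?_⟩
  have hfz := hf.comp hzL
  obtain ⟨C, hC⟩ := (hfz.lipschitzOnWith (s := uIcc 0 t)).absolutelyContinuousOnInterval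
    |>.const_of_ae_hasDerivAt_zero (by
      have h0 : ∀ᵐ s : ℝ, s ≠ 0 := by simp [ae_iff]
      filter_upwards [hincl, hfz.ae_differentiableAt_real, h0] with s hs hds hs0 hmem
      rw [uIcc_of_le ht] at hmem
      obtain ⟨hd, hsub⟩ := hs (lt_of_le_of_ne hmem.1 hs0.symm)
      have := hsub.deriv_comp hd.hasDerivAt hds.hasDerivAt
      rw [inner_neg_left, hskew, neg_zero] at this
      rw [← this]
      exact hds.hasDerivAt)
  rw [← hz0]
  exact (hC t right_mem_uIcc).trans (hC 0 left_mem_uIcc).symm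

/-- Existence for `-J z' ∈ ∂f(z)` with a convex `f` one of whose sublevel sets is bounded and
contains the initial point: a globally Lipschitz minorant of `f`, equal to `f` on a larger ball,
is conserved, so that its trajectory never leaves that ball. -/
theorem exists_solution_of_bounded_sublevel [FiniteDimensional ℝ V] {f : V → ℝ}
    (hconv : ConvexOn ℝ univ f) {J : V →L[ℝ] V} (hJ : ∀ v, J (J v) = -v)
    (hskew : ∀ v, inner ℝ (J v) v = 0) (x₀ : V) {R : ℝ} (hR : ∀ x, f x ≤ f x₀ → ‖x‖ ≤ R) :
    ∃ (z : ℝ → V) (M : NNReal), z 0 = x₀ ∧ LipschitzWith M z ∧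
      ∀ᵐ t, 0 < t → DifferentiableAt ℝ z t ∧ IsSubgradient f (z t) (-J (deriv z t)) := by
  have hx₀ : ‖x₀‖ ≤ R := hR x₀ le_rfl
  have hR0 : 0 ≤ R := (norm_nonneg _).trans hx₀
  obtain ⟨K, f', hconv', hlip, hle, heq⟩ := exists_lipschitz_convex_minorant hconv
    (show 0 ≤ R + 1 by linarith)
  obtain ⟨z, M, hz0, hzL, hincl, hcons⟩ := exists_solution_of_lipschitz hconv' hlip hJ hskew x₀
  have hball : ∀ t, 0 ≤ t → ‖z t‖ ≤ R + 1 := by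
    intro t ht
    by_contra! hlt
    -- At a time `s` with `‖z s‖ = R + 1` the minorant still agrees with `f`, so conservation gives
    -- `f (z s) = f x₀` and hence `‖z s‖ ≤ R`.
    obtain ⟨s, hs, hsn⟩ := intermediate_value_Icc ht hzL.continuous.norm.continuousOn
      (show R + 1 ∈ Icc ‖z 0‖ ‖z t‖ from ⟨by rw [hz0]; linarith, hlt.le⟩)
    have hsn : ‖z s‖ = R + 1 := hsn
    have h1 := hcons s hs.1
    rw [heq _ hsn.le, heq x₀ (by linarith)] at h1
    linarith [hR _ h1.le]
  refine ⟨z, M, hz0, hzL, ?_⟩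
  filter_upwards [hincl] with t ht htpos
  obtain ⟨hd, hsub⟩ := ht htpos
  refine ⟨hd, fun w => ?_⟩
  rw [← heq _ (hball t htpos.le)]
  exact (hsub w).trans (hle w)

end HamiltonianInclusion

/-! ### The action functional -/

section Action

variable {N : ℕ}

theorem conj_le_of_mem_subdiff {H : Euc N × Euc N → ℝ} {x y : Euc N × Euc N}
    (h : y ∈ subdiff H x) : conj H y ≤ ((inner ℝ y.1 x.1 + inner ℝ y.2 x.2 - H x : ℝ) : EReal) := by
  refine iSup_le fun z => EReal.coe_le_coe_iff.2 ?_
  have := h z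
  simp only [inner_sub_right] at this
  linarith

theorem le_conj (H : Euc N × Euc N → ℝ) (x y : Euc N × Euc N) :
    ((inner ℝ y.1 x.1 + inner ℝ y.2 x.2 - H x : ℝ) : EReal) ≤ conj H y :=
  le_iSup (fun x : Euc N × Euc N =>
    ((inner ℝ y.1 x.1 + inner ℝ y.2 x.2 - H x : ℝ) : EReal)) x

/-- The Fenchel-Young inequality: the integrand of the action is nonnegative. -/
theorem integrand_nonneg (H : Euc N × Euc N → ℝ) (p q u v : Euc N) :
    0 ≤ (H (p, q) : EReal) + conj H (-v, u) + ((inner ℝ v p - inner ℝ u q : ℝ) : EReal) := by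
  have h := add_le_add (add_le_add (le_refl (H (p, q) : EReal)) (le_conj H (p, q) (-v, u)))
    (le_refl ((inner ℝ v p - inner ℝ u q : ℝ) : EReal))
  refine le_trans (le_of_eq ?_) h
  rw [← EReal.coe_add, ← EReal.coe_add, ← EReal.coe_zero, inner_neg_left]
  congr 1
  ring

theorem integrand_eq_zero {H : Euc N × Euc N → ℝ} {p q u v : Euc N}
    (h : (-v, u) ∈ subdiff H (p, q)) :
    (H (p, q) : EReal) + conj H (-v, u) + ((inner ℝ v p - inner ℝ u q : ℝ) : EReal) = 0 := by
  rw [le_antisymm (conj_le_of_mem_subdiff h) (le_conj H (p, q) (-v, u)),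
    ← EReal.coe_add, ← EReal.coe_add, ← EReal.coe_zero, inner_neg_left]
  congr 1
  ring

theorem actionJ_nonneg (H : Euc N × Euc N → ℝ) (T : ℝ) (c : (ℝ → Euc N) × (ℝ → Euc N)) :
    0 ≤ actionJ H T c := by
  unfold actionJ eintegral
  have : ∀ t, (-((H (c.1 t, c.2 t) : EReal) + conj H (-deriv c.2 t, deriv c.1 t)
      + ((inner ℝ (deriv c.2 t) (c.1 t) - inner ℝ (deriv c.1 t) (c.2 t) : ℝ) : EReal))).toENNReal
      = 0 := fun t => by
    rw [EReal.toENNReal_eq_zero_iff, EReal.neg_le, neg_zero]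
    exact integrand_nonneg H _ _ _ _
  simp only [this, lintegral_zero, EReal.coe_ennreal_zero, sub_zero]
  exact EReal.coe_ennreal_nonneg _

theorem eintegral_eq_zero {T : ℝ} {f : ℝ → EReal}
    (h : ∀ᵐ t ∂(volume.restrict (Ioo 0 T)), f t = 0) : eintegral T f = 0 := by
  have h1 : ∫⁻ t in Ioo 0 T, (f t).toENNReal = 0 := by
    rw [lintegral_congr_ae (g := fun _ => 0) (h.mono fun t ht => by simp [ht]), lintegral_zero]
  have h2 : ∫⁻ t in Ioo 0 T, (-f t).toENNReal = 0 := by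
    rw [lintegral_congr_ae (g := fun _ => 0) (h.mono fun t ht => by simp [ht]), lintegral_zero]
  simp [eintegral, h1, h2]

theorem actionJ_eq_zero {H : Euc N × Euc N → ℝ} {T : ℝ} {p q : ℝ → Euc N}
    (h : ∀ᵐ t ∂(volume.restrict (Ioo 0 T)), (-deriv q t, deriv p t) ∈ subdiff H (p t, q t)) :
    actionJ H T (p, q) = 0 := by
  exact eintegral_eq_zero (h.mono fun t ht => integrand_eq_zero ht)

theorem mem_subdiffFst_of_mem_subdiff {H : Euc N × Euc N → ℝ} {p q u v : Euc N}
    (h : (u, v) ∈ subdiff H (p, q)) : u ∈ subdiffFst H p q := fun z => by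
  simpa using h (z, q)

theorem mem_subdiffSnd_of_mem_subdiff {H : Euc N × Euc N → ℝ} {p q u v : Euc N}
    (h : (u, v) ∈ subdiff H (p, q)) : v ∈ subdiffSnd H p q := fun z => by
  simpa using h (p, z)

theorem isW12_of_lipschitzWith {T : ℝ} {p : ℝ → Euc N} {K : NNReal} (hp : LipschitzWith K p) :
    IsW12 T p :=
  ⟨hp.lipschitzOnWith.absolutelyContinuousOnInterval,
    MemLp.of_bound (measurable_deriv p).aestronglyMeasurable K
      (Eventually.of_forall fun _ => norm_deriv_le_of_lipschitz hp)⟩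

end Action

/-! ### The Hamiltonian inclusion in phase space -/

section PhaseSpace

variable {N : ℕ}

/-- The phase space `ℝ^N × ℝ^N` with its Euclidean norm. -/
abbrev Phase (N : ℕ) : Type := WithLp 2 (Euc N × Euc N)

/-- The symplectic rotation `(u, v) ↦ (v, -u)`. -/
def sympl (N : ℕ) : Phase N →L[ℝ] Phase N :=
  (WithLp.prodContinuousLinearEquiv 2 ℝ (Euc N) (Euc N)).symm.toContinuousLinearMap.comp
    ((WithLp.sndL 2 ℝ (Euc N) (Euc N)).prod (-WithLp.fstL 2 ℝ (Euc N) (Euc N)))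

theorem sympl_apply (x : Phase N) : sympl N x = WithLp.toLp 2 (x.snd, -x.fst) := rfl

theorem sympl_sympl (x : Phase N) : sympl N (sympl N x) = -x := rfl

theorem inner_sympl_self (x : Phase N) : inner ℝ (sympl N x) x = 0 := by
  rw [WithLp.prod_inner_apply, sympl_apply]
  simp [real_inner_comm]

/-- Existence of a Lipschitz solution of the Hamiltonian inclusion; a joint subgradient
`g = (-q', p')` at `z = (p, q)` is the same as `g = -sympl z'`. -/
theorem exists_lipschitz_hamiltonian_solution {H : Euc N × Euc N → ℝ}
    (hconv : ConvexOn ℝ univ H)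
    (hcoer : Tendsto H (comap (fun x => ‖x.1‖ + ‖x.2‖) atTop) atTop) (p₀ q₀ : Euc N) :
    ∃ (p q : ℝ → Euc N) (K : NNReal), p 0 = p₀ ∧ q 0 = q₀ ∧ LipschitzWith K p ∧
      LipschitzWith K q ∧ ∀ᵐ t, 0 < t → DifferentiableAt ℝ p t ∧ DifferentiableAt ℝ q t ∧
        (-deriv q t, deriv p t) ∈ subdiff H (p t, q t) := by
  have hconv' : ConvexOn ℝ univ (fun x : Phase N => H (WithLp.ofLp x)) :=
    hconv.comp_linearMap (WithLp.linearEquiv 2 ℝ (Euc N × Euc N)).toLinearMap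
  obtain ⟨s, hs, hsub⟩ := mem_comap.1 (hcoer (eventually_gt_atTop (H (p₀, q₀))))
  obtain ⟨R, hR⟩ := mem_atTop_sets.1 hs
  have hbd : ∀ x : Phase N, H (WithLp.ofLp x) ≤ H (p₀, q₀) → ‖x‖ ≤ R := by
    intro x hx
    by_contra! hlt
    have h1 : ‖x‖ ≤ ‖x.fst‖ + ‖x.snd‖ := by
      rw [WithLp.prod_norm_eq_of_L2, Real.sqrt_le_left (by positivity)]
      nlinarith [mul_nonneg (norm_nonneg x.fst) (norm_nonneg x.snd)]
    have h2 : H (p₀, q₀) < H (WithLp.ofLp x) := hsub (hR _ (hlt.le.trans h1))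
    exact absurd hx h2.not_ge
  obtain ⟨z, M, hz0, hzL, hz⟩ := exists_solution_of_bounded_sublevel hconv' sympl_sympl
    inner_sympl_self (WithLp.toLp 2 (p₀, q₀)) hbd
  have hnorm : ∀ x : Phase N, ‖x.fst‖ ≤ ‖x‖ ∧ ‖x.snd‖ ≤ ‖x‖ := fun x => by
    rw [WithLp.prod_norm_eq_of_L2]
    constructor <;> refine Real.le_sqrt_of_sq_le ?_ <;>
      nlinarith [sq_nonneg ‖x.fst‖, sq_nonneg ‖x.snd‖]
  refine ⟨fun t => (z t).fst, fun t => (z t).snd, M, by simp [hz0], by simp [hz0],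
    LipschitzWith.of_dist_le_mul fun t s => ?_, LipschitzWith.of_dist_le_mul fun t s => ?_, ?_⟩
  · refine le_trans ?_ (hzL.dist_le_mul t s)
    rw [dist_eq_norm, dist_eq_norm, ← WithLp.sub_fst]
    exact (hnorm _).1
  · refine le_trans ?_ (hzL.dist_le_mul t s)
    rw [dist_eq_norm, dist_eq_norm, ← WithLp.sub_snd]
    exact (hnorm _).2
  · filter_upwards [hz] with t ht htpos
    obtain ⟨hd, hsub⟩ := ht htpos
    have hp : HasDerivAt (fun t => (z t).fst) (deriv z t).fst t :=
      (WithLp.fstL 2 ℝ (Euc N) (Euc N)).hasFDerivAt.comp_hasDerivAt t hd.hasDerivAt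
    have hq : HasDerivAt (fun t => (z t).snd) (deriv z t).snd t :=
      (WithLp.sndL 2 ℝ (Euc N) (Euc N)).hasFDerivAt.comp_hasDerivAt t hd.hasDerivAt
    refine ⟨hp.differentiableAt, hq.differentiableAt, fun w => ?_⟩
    have h1 := hsub (WithLp.toLp 2 w)
    rw [WithLp.prod_inner_apply, sympl_apply] at h1
    rw [hp.deriv, hq.deriv]
    change H (z t).ofLp + _ ≤ H w
    simpa using h1

end PhaseSpace

end HamiltonianCauchy

end

theorem theorem2 {N : ℕ} (H : HamiltonianCauchy.Euc N × HamiltonianCauchy.Euc N → ℝ)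
    (hconv : ConvexOn ℝ Set.univ H) (hlsc : LowerSemicontinuous H)
    (hcoer : Filter.Tendsto H
      (Filter.comap (fun x => ‖x.1‖ + ‖x.2‖) Filter.atTop) Filter.atTop)
    (α β r : ℝ) (hα : 0 < α) (hβ : 0 < β) (hr : 1 < r)
    (hgrowth : ∀ p q, -α ≤ H (p, q) ∧ H (p, q) ≤ β * (‖p‖ ^ r + ‖q‖ ^ r + 1))
    (T : ℝ) (hT : 0 < T) (p₀ q₀ : HamiltonianCauchy.Euc N) :
    sInf (HamiltonianCauchy.actionJ H T '' HamiltonianCauchy.pathsFrom T p₀ q₀) = 0 ∧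
    ∃ p q : ℝ → HamiltonianCauchy.Euc N,
      (p, q) ∈ HamiltonianCauchy.pathsFrom T p₀ q₀ ∧
      HamiltonianCauchy.actionJ H T (p, q) = 0 ∧
      HamiltonianCauchy.IsSolution H T p₀ q₀ p q := by
  obtain ⟨p, q, K, hp0, hq0, hpL, hqL, hae⟩ :=
    HamiltonianCauchy.exists_lipschitz_hamiltonian_solution hconv hcoer p₀ q₀
  have hpW : HamiltonianCauchy.IsW12 T p := HamiltonianCauchy.isW12_of_lipschitzWith hpL
  have hqW : HamiltonianCauchy.IsW12 T q := HamiltonianCauchy.isW12_of_lipschitzWith hqL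
  have hae' : ∀ᵐ t ∂(volume.restrict (Ioo 0 T)), DifferentiableAt ℝ p t ∧
      DifferentiableAt ℝ q t ∧ (-deriv q t, deriv p t) ∈ HamiltonianCauchy.subdiff H (p t, q t) :=
    (ae_restrict_iff' measurableSet_Ioo).2 (hae.mono fun t ht hmem => ht hmem.1)
  have hmem : (p, q) ∈ HamiltonianCauchy.pathsFrom T p₀ q₀ := ⟨hpW, hqW, hp0, hq0⟩
  have hzero : HamiltonianCauchy.actionJ H T (p, q) = 0 :=
    HamiltonianCauchy.actionJ_eq_zero (hae'.mono fun t ht => ht.2.2)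
  refine ⟨le_antisymm (sInf_le ⟨(p, q), hmem, hzero⟩) (le_sInf ?_), p, q, hmem, hzero, ?_⟩
  · rintro _ ⟨c, -, rfl⟩
    exact HamiltonianCauchy.actionJ_nonneg H T c
  · exact
      { memFst := hpW
        memSnd := hqW
        initFst := hp0
        initSnd := hq0
        differentiable := hae'.mono fun t ht => ⟨ht.1, ht.2.1⟩
        eqFst := hae'.mono fun t ht => HamiltonianCauchy.mem_subdiffSnd_of_mem_subdiff ht.2.2
        eqSnd := hae'.mono fun t ht => HamiltonianCauchy.mem_subdiffFst_of_mem_subdiff ht.2.2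
        eqJoint := hae'.mono fun t ht => ht.2.2 }
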